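/- Let $q$ be a prime power, let $A=(a_{ij})\in\mathbb{F}_q^{m\times k}$, and consider the system $(\star)$ of linear equations $a_{i1}x_1+\cdots+a_{ik}x_k=0$ $(1\le i\le m)$, where the variables $x_1,\dots,x_k$ take values in $\mathbb{F}_q^n$. Call two indices $j,j'\in\{1,\dots,k\}$ equivalent if the $j$-th and $j'$-th columns of $A$ are nonzero scalar multiples of one another; the equivalence classes are called column equivalence classes, and such a class is said to sum to zero if the columns of $A$ indexed by it add up to the zero vector. Assume that: (1) $(\star)$ is of type (RC), i.e. every row of $A$ sums to zero, and at most one column equivalence class has size $1$; (2) $(\star)$ is non-degenerate, i.e. the rows of $A$ are linearly independent and no column of $A$ is zero; (3) $(\star)$ is irreducible, i.e. there are no matrix $A'\in\mathbb{F}_q^{m'\times k}$ (for any $m'$) with the same row space as $A$ and no partition of $\{1,\dots,k\}$ into two or more non-empty classes such that the nonzero entries of each row of $A'$ all lie in columns from a single class of the partition. Suppose moreover that at least one of the following holds: (i) no column equivalence class of size $2$ sums to zero; (ii) every column equivalence class sums to zero, and $k\ge 3$. Then $(\star)$ is moderate: there exist constants $\beta,\gamma>0$ with $\gamma<q$ such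 that, for every $n$, every subset $S\subseteq\mathbb{F}_q^n$ of size at least $\beta\gamma^n$ contains pairwise distinct vectors $x_1,\dots,x_k$ that satisfy $(\star)$. -/

import Mathlib

/-! Linear systems `A x = 0` whose coefficients lie in a field `F` and whose variables
`x 0, …, x (k - 1)` range over the vector space `Fin n → F`. -/

namespace LinSys

variable {F : Type*} [Field F] {m m' k : ℕ}

/-- The tuple `x` of vectors solves every equation `∑ j, A i j • x j = 0`. -/
def IsSolution (A : Matrix (Fin m) (Fin k) F) {n : ℕ} (x : Fin k → Fin n → F) : Prop :=
  ∀ i, ∑ j, A i j • x j = 0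

/-- A shape of the system: a solution whose vectors are pairwise distinct. -/
def IsShape (A : Matrix (Fin m) (Fin k) F) {n : ℕ} (x : Fin k → Fin n → F) : Prop :=
  IsSolution A x ∧ Function.Injective x

/-- The coefficients of every equation sum to zero. -/
def IsBalanced (A : Matrix (Fin m) (Fin k) F) : Prop :=
  ∀ i, ∑ j, A i j = 0

/-- Two indices are equivalent if the corresponding columns are nonzero scalar multiples of one
another. -/
def columnSetoid (A : Matrix (Fin m) (Fin k) F) : Setoid (Fin k) where
  r j j' := ∃ c : F, c ≠ 0 ∧ A.col j' = c • A.col j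
  iseqv :=
    { refl := fun _ => ⟨1, one_ne_zero, (one_smul _ _).symm⟩
      symm := by
        rintro j j' ⟨c, hc, h⟩
        exact ⟨c⁻¹, inv_ne_zero hc, by rw [h, smul_smul, inv_mul_cancel₀ hc, one_smul]⟩
      trans := by
        rintro j j' j'' ⟨c, hc, h⟩ ⟨d, hd, h'⟩
        exact ⟨d * c, mul_ne_zero hd hc, by rw [h', h, smul_smul]⟩ }

/-- The column equivalence classes, as subsets of the index set. -/
def columnClasses (A : Matrix (Fin m) (Fin k) F) : Set (Set (Fin k)) :=
  (columnSetoid A).classes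

/-- Type (RC): balanced, with at most one column equivalence class of size 1. -/
def IsTypeRC (A : Matrix (Fin m) (Fin k) F) : Prop :=
  IsBalanced A ∧ {C | C ∈ columnClasses A ∧ C.ncard = 1}.Subsingleton

open Classical in
/-- The columns indexed by `C` add up to the zero vector. -/
def SumsToZero (A : Matrix (Fin m) (Fin k) F) (C : Set (Fin k)) : Prop :=
  ∑ j with j ∈ C, A.col j = 0

/-- The rows are linearly independent and every variable is used. -/
def IsNondegenerate (A : Matrix (Fin m) (Fin k) F) : Prop :=
  LinearIndependent F A.row ∧ ∀ j, ∃ i, A i j ≠ 0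

/-- Each equation of either system is a linear combination of the equations of the other. -/
def AreEquivalent (A : Matrix (Fin m) (Fin k) F) (A' : Matrix (Fin m') (Fin k) F) : Prop :=
  (∀ i, A.row i ∈ Submodule.span F (Set.range A'.row)) ∧
    ∀ i, A'.row i ∈ Submodule.span F (Set.range A.row)

/-- The system is equivalent to one in which each equation only uses variables from one class of
a fixed partition of the variables into at least two (non-empty) classes. -/
def IsReducible (A : Matrix (Fin m) (Fin k) F) : Prop :=
  ∃ (m' : ℕ) (A' : Matrix (Fin m') (Fin k) F), AreEquivalent A A' ∧
    ∃ P : Finpartition (Finset.univ : Finset (Fin k)), 2 ≤ P.parts.card ∧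
      ∀ i, ∃ C ∈ P.parts, ∀ j, A' i j ≠ 0 → j ∈ C

/-- The system is not reducible. -/
def IsIrreducible (A : Matrix (Fin m) (Fin k) F) : Prop :=
  ¬ IsReducible A

/-- For some `β > 0` and `0 < γ < |F|`, every set of at least `β * γ ^ n` vectors of `F ^ n`
contains a shape of the system, for every `n`. -/
def IsModerate [Fintype F] (A : Matrix (Fin m) (Fin k) F) : Prop :=
  ∃ β γ : ℝ, 0 < β ∧ 0 < γ ∧ γ < (Fintype.card F : ℝ) ∧
    ∀ (n : ℕ) (S : Finset (Fin n → F)), β * γ ^ n ≤ (S.card : ℝ) →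
      ∃ x : Fin k → Fin n → F, (∀ j, x j ∈ S) ∧ IsShape A x

end LinSys

/-! Choose a representative column `b a` in each class `a` and write column `j` as `c j • b (f j)`.
The system becomes `∑ a, b a ⊗ y a = 0` with `y a = ∑ j with f j = a, c j • x j`, so each class
enters only through one linear expression in its own variables.

The main tool is `isSolvableInLarge_of_three_le`, on a single balanced equation. Three terms are
handled by the polynomial method (slice rank); longer equations by merging two variables, or by
pigeonhole in characteristic 2. Adjoining one more variable `x` to a class equation shows that, for
all but few `x ∈ S`, the value `(∑ c j) • x` is popular: it is represented by distinct vectors of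
`S` even after a bounded set is forbidden. Hence the classes can be filled one after another without
collisions.

In case (i), give every class the value it would have if all its variables were equal to one generic
`x`; balance makes the total zero, and the only possible singleton class takes `x` itself. In case
(ii) with several classes, irreducibility means that the `b a` still span after any one is removed.
Pigeonhole then gives distinct `x a`, `x' a` with `∑ a, b a ⊗ (x a - x' a) = 0`. One variable of the
class takes the value `x a`, and the others are chosen to contribute `-x' a`. -/

namespace LinSys

/-! ### Slice rank and three-term equations -/

/-- A tensor supported exactly on the diagonal that decomposes into slices taken from a family of
`#I` functions has side length at most `2 * #I`. -/
lemma card_le_of_diagonal_slices {F X E κ : Type*} [Field F] [Finite F] [Fintype X]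
    (I : Finset κ) (u : κ → X → F) (T : X → X → X → F) (E₁ E₂ E₃ : Finset E)
    (a₁ a₂ a₃ : E → κ) (g₁ g₂ g₃ : E → X → X → F)
    (h₁ : ∀ e ∈ E₁, a₁ e ∈ I) (h₂ : ∀ e ∈ E₂, a₂ e ∈ I) (h₃ : ∀ e ∈ E₃, a₃ e ∈ I)
    (hT : ∀ x y z, T x y z = ∑ e ∈ E₁, u (a₁ e) x * g₁ e y z +
      ∑ e ∈ E₂, u (a₂ e) y * g₂ e x z + ∑ e ∈ E₃, u (a₃ e) z * g₃ e x y)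
    (hdiag : ∀ x, T x x x ≠ 0) (hoff : ∀ x y z, T x y z ≠ 0 → y = x ∧ z = x) :
    Fintype.card X ≤ 2 * I.card := by
  classical
  let L : (X → F) →ₗ[F] (I → F) := Matrix.mulVecLin (Matrix.of fun (i : I) x => u i x)
  let W := LinearMap.ker L
  let U := Submodule.span F (Set.range fun i : I => u i)
  have hW : ∀ v ∈ W, ∀ i ∈ I, ∑ x, u i x * v x = 0 := fun v hv i hi =>
    congrFun (LinearMap.mem_ker.1 hv) ⟨i, hi⟩
  have hWdim : Fintype.card X ≤ Module.finrank F W + I.card := by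
    have h1 := LinearMap.finrank_range_add_finrank_ker L
    have h2 := Submodule.finrank_le (LinearMap.range L)
    simp only [Module.finrank_fintype_fun_eq_card, Fintype.card_coe] at h1 h2
    change _ ≤ Module.finrank F (LinearMap.ker L) + _
    omega
  have hUdim : Module.finrank F U ≤ I.card := by
    have := finrank_range_le_card (R := F) (fun i : I => u i)
    rwa [Fintype.card_coe] at this
  -- Contracting `T` with `h` in the third variable kills the third kind of slice. Maximal support
  -- of `h` makes `φ` injective on `W`: if `h * v = 0` with `v ≠ 0`, then `h + v` has larger
  -- support. As `φ` maps `W` into `U`, this gives `#X - #I ≤ dim W ≤ dim U ≤ #I`.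
  obtain ⟨h, hhW, hmax⟩ := Set.exists_max_image (W : Set (X → F))
    (fun v => (Finset.univ.filter fun x => v x ≠ 0).card) (Set.toFinite _) ⟨0, W.zero_mem⟩
  let φ : (X → F) →ₗ[F] (X → F) := LinearMap.mulLeft F (fun x => T x x x * h x)
  have hφ : ∀ v ∈ W, φ v ∈ U := by
    intro v hv
    have key : φ v = ∑ e ∈ E₁, (∑ y, ∑ z, g₁ e y z * h z * v y) • u (a₁ e) := by
      funext x
      have e1 : φ v x = ∑ y, ∑ z, T x y z * h z * v y := by
        rw [Finset.sum_eq_single x, Finset.sum_eq_single x]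
        · simp [φ]
        · intro z _ hz
          by_cases h0 : T x x z = 0
          · simp [h0]
          · exact absurd (hoff _ _ _ h0).2 hz
        · simp
        · intro y _ hy
          refine Finset.sum_eq_zero fun z _ => ?_
          by_cases h0 : T x y z = 0
          · simp [h0]
          · exact absurd (hoff _ _ _ h0).1 hy
        · simp
      have z2 : ∑ y, ∑ z, (∑ e ∈ E₂, u (a₂ e) y * g₂ e x z) * h z * v y = 0 := by
        rw [Finset.sum_comm]
        refine Finset.sum_eq_zero fun z _ => ?_
        simp_rw [Finset.sum_mul]
        rw [Finset.sum_comm]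
        refine Finset.sum_eq_zero fun e he => ?_
        have := hW v hv _ (h₂ e he)
        calc _ = (g₂ e x z * h z) * ∑ y, u (a₂ e) y * v y := by
              rw [Finset.mul_sum]; exact Finset.sum_congr rfl fun _ _ => by ring
          _ = 0 := by rw [this, mul_zero]
      have z3 : ∑ y, ∑ z, (∑ e ∈ E₃, u (a₃ e) z * g₃ e x y) * h z * v y = 0 := by
        refine Finset.sum_eq_zero fun y _ => ?_
        simp_rw [Finset.sum_mul]
        rw [Finset.sum_comm]
        refine Finset.sum_eq_zero fun e he => ?_
        have := hW h hhW _ (h₃ e he)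
        calc _ = (g₃ e x y * v y) * ∑ z, u (a₃ e) z * h z := by
              rw [Finset.mul_sum]; exact Finset.sum_congr rfl fun _ _ => by ring
          _ = 0 := by rw [this, mul_zero]
      rw [e1]
      simp_rw [hT, add_mul, Finset.sum_add_distrib]
      rw [z2, z3, add_zero, add_zero]
      simp only [Finset.sum_apply, Pi.smul_apply, smul_eq_mul, Finset.sum_mul]
      symm
      rw [Finset.sum_comm]
      refine Finset.sum_congr rfl fun y _ => ?_
      rw [Finset.sum_comm]
      exact Finset.sum_congr rfl fun z _ => Finset.sum_congr rfl fun e _ => by ring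
    rw [key]
    exact Submodule.sum_mem _ fun e he =>
      Submodule.smul_mem _ _ (Submodule.subset_span ⟨⟨a₁ e, h₁ e he⟩, rfl⟩)
  have hinj : Function.Injective (φ.restrict hφ) := by
    rw [← LinearMap.ker_eq_bot, LinearMap.ker_eq_bot']
    rintro ⟨v, hv⟩ h0
    have hv0 : ∀ x, h x * v x = 0 := by
      intro x
      have := congrFun (congrArg Subtype.val h0) x
      simpa [φ, hdiag x] using this
    by_contra hne
    obtain ⟨x, hx⟩ : ∃ x, v x ≠ 0 := by
      by_contra! hc
      exact hne (Subtype.ext (funext hc))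
    refine absurd (hmax (h + v) (W.add_mem hhW hv)) (not_le.2 (Finset.card_lt_card ?_))
    refine ⟨fun y hy => ?_, fun hsub => ?_⟩
    · simp only [Finset.mem_filter, Finset.mem_univ, true_and, Pi.add_apply] at hy ⊢
      have : v y = 0 := (mul_eq_zero.1 (hv0 y)).resolve_left hy
      simpa [this] using hy
    · have hhx : h x = 0 := (mul_eq_zero.1 (hv0 x)).resolve_right hx
      have := @hsub x (by simpa [hhx] using hx)
      simp [hhx] at this
  have := LinearMap.finrank_le_finrank_of_injective hinj
  omega

/-- The exponent vectors in `[0, q)ⁿ` of degree at most `(q - 1) n / 3`. -/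
def lowExponents (q n : ℕ) : Finset (Fin n → ℕ) :=
  (Fintype.piFinset fun _ => Finset.range q).filter fun M => 3 * ∑ i, M i ≤ (q - 1) * n

/-- Exponential moment bound: for `0 < t < 1`, weighting each exponent vector by `t ^ (3 * degree)`
gives `γ = (∑ j < q, t ^ (3 * j)) / t ^ (q - 1)`. -/
lemma exists_card_lowExponents_le {q : ℕ} (hq : 2 ≤ q) :
    ∃ γ : ℝ, 0 < γ ∧ γ < q ∧ ∀ n, ((lowExponents q n).card : ℝ) ≤ γ ^ n := by
  obtain ⟨t, ht0, ht1, ht⟩ : ∃ t : ℝ, 0 < t ∧ t < 1 ∧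
      ∑ j ∈ Finset.range q, t ^ (3 * j) < q * t ^ (q - 1) := by
    -- `g 1 = 0` and `g' = q (q - 1) - 3 q (q - 1) / 2 < 0`, so `g` is positive just to the left of
    -- `1`.
    let g : ℝ → ℝ := fun t => q * t ^ (q - 1) - ∑ j ∈ Finset.range q, t ^ (3 * j)
    let g' : ℝ := q * ((q - 1 : ℕ) * 1 ^ (q - 1 - 1)) -
      ∑ j ∈ Finset.range q, ((3 * j : ℕ) : ℝ) * 1 ^ (3 * j - 1)
    have hg : HasDerivAt g g' 1 :=
      ((hasDerivAt_pow _ _).const_mul _).sub (HasDerivAt.fun_sum fun j _ => hasDerivAt_pow _ _)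
    have hneg : g' < 0 := by
      have h1 : (∑ j ∈ Finset.range q, (j : ℝ)) * 2 = q * (q - 1) := by
        have := Finset.sum_range_id_mul_two q
        have h2 : ((∑ j ∈ Finset.range q, j : ℕ) : ℝ) * 2 = (q * (q - 1) : ℕ) := by
          exact_mod_cast this
        rw [Nat.cast_mul, Nat.cast_sub (by omega)] at h2
        push_cast at h2
        exact h2
      have hq' : (2 : ℝ) ≤ q := by exact_mod_cast hq
      simp only [g', one_pow, mul_one]
      rw [Nat.cast_sub (by omega)]
      push_cast
      rw [← Finset.mul_sum]
      nlinarith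
    have hg1 : g 1 = 0 := by simp [g]
    have hs := (hasDerivAt_iff_tendsto_slope.1 hg).eventually_lt_const hneg
    have hs' : ∀ᶠ x in nhdsWithin (1 : ℝ) (Set.Iio 1), slope g 1 x < 0 :=
      hs.filter_mono (nhdsWithin_mono 1 (fun x (hx : x < 1) => hx.ne))
    have h01 : ∀ᶠ x : ℝ in nhdsWithin 1 (Set.Iio 1), 0 < x :=
      (eventually_gt_nhds one_pos).filter_mono nhdsWithin_le_nhds
    obtain ⟨t, ⟨hst, ht0⟩, ht1⟩ := ((hs'.and h01).and self_mem_nhdsWithin).exists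
    refine ⟨t, ht0, ht1, ?_⟩
    rw [slope_def_field, hg1, sub_zero] at hst
    have ht1' : t - 1 < 0 := sub_neg.2 ht1
    have : 0 < g t := by
      by_contra hc
      exact absurd hst (not_lt.2 (div_nonneg_of_nonpos (not_lt.1 hc) ht1'.le))
    exact sub_pos.1 this
  have htp : 0 < t ^ (q - 1) := by positivity
  have hsum : 0 < ∑ j ∈ Finset.range q, t ^ (3 * j) :=
    Finset.sum_pos (fun _ _ => by positivity) ⟨0, by simp; omega⟩
  refine ⟨(∑ j ∈ Finset.range q, t ^ (3 * j)) / t ^ (q - 1), div_pos hsum htp,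
    (div_lt_iff₀ htp).2 ht, fun n => ?_⟩
  rw [div_pow, le_div_iff₀ (by positivity), ← pow_mul]
  calc ((lowExponents q n).card : ℝ) * t ^ ((q - 1) * n)
      = ∑ M ∈ lowExponents q n, t ^ ((q - 1) * n) := by simp
    _ ≤ ∑ M ∈ lowExponents q n, ∏ i, t ^ (3 * M i) := by
        refine Finset.sum_le_sum fun M hM => ?_
        rw [Finset.prod_pow_eq_pow_sum, ← Finset.mul_sum]
        exact pow_le_pow_of_le_one ht0.le ht1.le (Finset.mem_filter.1 hM).2
    _ ≤ ∑ M ∈ Fintype.piFinset fun _ : Fin n => Finset.range q, ∏ i, t ^ (3 * M i) :=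
        Finset.sum_le_sum_of_subset_of_nonneg (Finset.filter_subset _ _)
          fun _ _ _ => by positivity
    _ = (∑ j ∈ Finset.range q, t ^ (3 * j)) ^ n := by
        have := Finset.prod_univ_sum (fun _ : Fin n => Finset.range q) (fun _ j => t ^ (3 * j))
        rw [← this]; simp

/-- For `d = q - 1` the left side is the indicator of `∑ c t * w t = 0`. Only the degree bound on
its monomials is needed later, not the coefficients. -/
lemma exists_one_sub_sum_pow_eq {F : Type*} [Field F] (c : Fin 3 → F) {d : ℕ} (hd : d ≠ 0) :
    ∃ (E : Finset (Fin 3 → ℕ)) (a : (Fin 3 → ℕ) → F), (∀ e ∈ E, ∑ t, e t ≤ d) ∧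
      ∀ w : Fin 3 → F, 1 - (∑ t, c t * w t) ^ d = ∑ e ∈ E, a e * ∏ t, w t ^ e t := by
  classical
  have h0 : (0 : Fin 3 → ℕ) ∉ Finset.piAntidiag Finset.univ d := by simp [hd.symm]
  refine ⟨insert 0 (Finset.piAntidiag Finset.univ d),
    fun e => if e = 0 then 1 else -(Nat.multinomial Finset.univ e * ∏ t, c t ^ e t), ?_, ?_⟩
  · intro e he
    rcases Finset.mem_insert.1 he with rfl | he
    · simp
    · exact (Finset.mem_piAntidiag.1 he).1.le
  · intro w
    rw [Finset.sum_insert h0, Finset.sum_pow_eq_sum_piAntidiag, sub_eq_add_neg,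
      ← Finset.sum_neg_distrib]
    congr 1
    · simp
    · refine Finset.sum_congr rfl fun e he => ?_
      have he0 : e ≠ 0 := by
        rintro rfl
        exact h0 he
      simp only [if_neg he0, mul_pow, Finset.prod_mul_distrib]
      ring

/-- A set in which `c 0 • x + c 1 • y + c 2 • z = 0` has only constant solutions is small. -/
lemma card_le_of_forall_three_term {F : Type*} [Field F] [Fintype F] {c : Fin 3 → F}
    (hsum : ∑ t, c t = 0) {n : ℕ} (S : Finset (Fin n → F))
    (hS : ∀ x ∈ S, ∀ y ∈ S, ∀ z ∈ S, c 0 • x + c 1 • y + c 2 • z = 0 → y = x ∧ z = x) :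
    S.card ≤ 2 * (lowExponents (Fintype.card F) n).card := by
  classical
  have hq : 1 < Fintype.card F := Fintype.one_lt_card
  have hd : Fintype.card F - 1 ≠ 0 := by omega
  obtain ⟨E, a, hE, hexp⟩ := exists_one_sub_sum_pow_eq c hd
  let P := Fintype.piFinset fun _ : Fin n => E
  let low : Fin 3 → (Fin n → Fin 3 → ℕ) → Prop := fun t p =>
    3 * ∑ i, p i t ≤ (Fintype.card F - 1) * n
  have hP : ∀ p ∈ P, ∀ i, ∑ t, p i t ≤ Fintype.card F - 1 := fun p hp i =>
    hE _ (Fintype.mem_piFinset.1 hp i)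
  -- The total degree is at most `(q - 1) n`, so one of the three partial degrees is at most a third
  -- of that. The slices below are sorted by the first variable whose degree is low.
  have hlow : ∀ p ∈ P, ¬ low 0 p → ¬ low 1 p → low 2 p := by
    intro p hp h0 h1
    have h2 : ∑ i, ∑ t, p i t ≤ ∑ _i : Fin n, (Fintype.card F - 1) :=
      Finset.sum_le_sum fun i _ => hP p hp i
    simp only [Fin.sum_univ_three, Finset.sum_add_distrib, Finset.sum_const, Finset.card_univ,
      Fintype.card_fin, smul_eq_mul] at h2
    simp only [low, not_le] at h0 h1 ⊢
    rw [mul_comm n] at h2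
    omega
  have hmem : ∀ t, ∀ p ∈ P, low t p → (fun i => p i t) ∈ lowExponents (Fintype.card F) n := by
    intro t p hp ht
    refine Finset.mem_filter.2 ⟨Fintype.mem_piFinset.2 fun i => Finset.mem_range.2 ?_, ht⟩
    have := (Finset.single_le_sum (f := p i) (fun _ _ => Nat.zero_le _)
      (Finset.mem_univ t)).trans (hP p hp i)
    omega
  have key := card_le_of_diagonal_slices (X := S) (lowExponents (Fintype.card F) n)
    (fun M x => ∏ i, (x : Fin n → F) i ^ M i)
    (fun x y z => ∏ i, (1 - (∑ t, c t * (![x.1 i, y.1 i, z.1 i] : Fin 3 → F) t) ^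
      (Fintype.card F - 1)))
    (P.filter (low 0)) ((P.filter fun p => ¬ low 0 p).filter (low 1))
    ((P.filter fun p => ¬ low 0 p).filter fun p => ¬ low 1 p)
    (fun p i => p i 0) (fun p i => p i 1) (fun p i => p i 2)
    (fun p y z => (∏ i, a (p i)) * (∏ i, y.1 i ^ p i 1) * ∏ i, z.1 i ^ p i 2)
    (fun p x z => (∏ i, a (p i)) * (∏ i, x.1 i ^ p i 0) * ∏ i, z.1 i ^ p i 2)
    (fun p x y => (∏ i, a (p i)) * (∏ i, x.1 i ^ p i 0) * ∏ i, y.1 i ^ p i 1)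
    ?_ ?_ ?_ ?_ ?_ ?_
  · simpa using key
  · intro p hp
    rw [Finset.mem_filter] at hp
    exact hmem _ p hp.1 hp.2
  · intro p hp
    rw [Finset.mem_filter, Finset.mem_filter] at hp
    exact hmem _ p hp.1.1 hp.2
  · intro p hp
    rw [Finset.mem_filter, Finset.mem_filter] at hp
    exact hmem _ p hp.1.1 (hlow p hp.1.1 hp.1.2 hp.2)
  · intro x y z
    have expand : ∏ i, (1 - (∑ t, c t * (![x.1 i, y.1 i, z.1 i] : Fin 3 → F) t) ^
        (Fintype.card F - 1)) = ∑ p ∈ P, (∏ i, a (p i)) * (∏ i, x.1 i ^ p i 0) *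
          (∏ i, y.1 i ^ p i 1) * ∏ i, z.1 i ^ p i 2 := by
      simp_rw [hexp]
      rw [Finset.prod_univ_sum]
      refine Finset.sum_congr rfl fun p _ => ?_
      simp [Finset.prod_mul_distrib, Fin.prod_univ_three, mul_assoc]
    rw [expand, ← Finset.sum_filter_add_sum_filter_not P (low 0), add_assoc,
      ← Finset.sum_filter_add_sum_filter_not (P.filter fun p => ¬ low 0 p) (low 1)]
    congr 1
    · exact Finset.sum_congr rfl fun p _ => by ring
    · congr 1
      · exact Finset.sum_congr rfl fun p _ => by ring
      · exact Finset.sum_congr rfl fun p _ => by ring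
  · intro x
    refine Finset.prod_ne_zero_iff.2 fun i _ => ?_
    have : ∑ t, c t * (![x.1 i, x.1 i, x.1 i] : Fin 3 → F) t = 0 := by
      rw [Fin.sum_univ_three] at hsum ⊢
      simp only [Matrix.cons_val]
      rw [← add_mul, ← add_mul, hsum, zero_mul]
    rw [this, zero_pow hd, sub_zero]
    exact one_ne_zero
  · intro x y z hne
    have := hS x x.2 y y.2 z z.2 (by
      funext i
      have hi := Finset.prod_ne_zero_iff.1 hne i (Finset.mem_univ i)
      by_contra h0
      refine hi (sub_eq_zero.2 (FiniteField.pow_card_sub_one_eq_one _ ?_).symm)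
      simpa [Fin.sum_univ_three] using h0)
    exact ⟨Subtype.ext this.1, Subtype.ext this.2⟩

/-! ### Properties of exponentially dense sets and of generic vectors -/

section Ubiquitous

variable {F : Type*} [Fintype F]

/-- All sets of at least `β * γ ^ n` vectors of `F ^ n` satisfy `P`, for suitable constants
`β ≥ 1` and `1 ≤ γ < |F|`. -/
def Ubiquitous (P : ∀ n, Finset (Fin n → F) → Prop) : Prop :=
  ∃ β γ : ℝ, 1 ≤ β ∧ 1 ≤ γ ∧ γ < Fintype.card F ∧
    ∀ (n : ℕ) (S : Finset (Fin n → F)), β * γ ^ n ≤ S.card → P n S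

variable {P Q : ∀ n, Finset (Fin n → F) → Prop}

lemma Ubiquitous.mono (h : Ubiquitous P) (hPQ : ∀ n S, P n S → Q n S) : Ubiquitous Q := by
  obtain ⟨β, γ, hβ, hγ, hγ', h⟩ := h
  exact ⟨β, γ, hβ, hγ, hγ', fun n S hS => hPQ n S (h n S hS)⟩

lemma Ubiquitous.and (hP : Ubiquitous P) (hQ : Ubiquitous Q) :
    Ubiquitous fun n S => P n S ∧ Q n S := by
  obtain ⟨β, γ, hβ, hγ, hγ', hP⟩ := hP
  obtain ⟨β', γ', hβ', hγ1, hγ1', hQ⟩ := hQ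
  refine ⟨max β β', max γ γ', le_max_of_le_left hβ, le_max_of_le_left hγ, max_lt hγ' hγ1',
    fun n S hS => ⟨hP n S (le_trans ?_ hS), hQ n S (le_trans ?_ hS)⟩⟩
  · gcongr
    · exact le_max_left _ _
    · exact le_max_left _ _
  · gcongr
    · exact le_max_right _ _
    · exact le_max_right _ _

/-- Ubiquitous properties hold for all subsets of a given positive proportion. -/
lemma Ubiquitous.subset (hP : Ubiquitous P) (D : ℕ) :
    Ubiquitous (F := F) fun n S => ∀ S' : Finset (Fin n → F), S.card ≤ D * S'.card + D → P n S' := by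
  obtain ⟨β, γ, hβ, hγ, hγ', hP⟩ := hP
  -- If `#S' < β γ ^ n`, then `#S ≤ D (β + 1) γ ^ n` because `γ ^ n ≥ 1`, which is below this
  -- threshold.
  refine ⟨(D + 1) * (β + 1), γ, ?_, hγ, hγ', fun n S hS S' hS' => hP n S' ?_⟩
  · have : (0 : ℝ) ≤ D := D.cast_nonneg
    nlinarith
  · have h1 : (S.card : ℝ) ≤ D * S'.card + D := by exact_mod_cast hS'
    have h2 : (1 : ℝ) ≤ γ ^ n := one_le_pow₀ hγ
    by_contra! hc
    have h3 : (0 : ℝ) ≤ D := D.cast_nonneg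
    have h4 : (D : ℝ) * S'.card ≤ D * (β * γ ^ n) := by gcongr
    have h5 : (D : ℝ) ≤ D * γ ^ n := by nlinarith
    nlinarith

/-- Normalises the constants. The strict inequality lets `β = γ = 0` express "all nonempty sets". -/
lemma Ubiquitous.of_lt [Nontrivial F] {β γ : ℝ} (hγ : γ < Fintype.card F) (hγ0 : 0 ≤ γ)
    (h : ∀ (n : ℕ) (S : Finset (Fin n → F)), β * γ ^ n < S.card → P n S) : Ubiquitous P := by
  have hq : (1 : ℝ) < Fintype.card F := by exact_mod_cast Fintype.one_lt_card
  refine ⟨max β 0 + 1, max γ 1, by simp, le_max_right _ _, max_lt hγ hq,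
    fun n S hS => h n S (lt_of_lt_of_le ?_ hS)⟩
  have h1 : (1 : ℝ) ≤ max γ 1 ^ n := one_le_pow₀ (le_max_right _ _)
  have h2 : γ ^ n ≤ max γ 1 ^ n := by gcongr; exact le_max_left _ _
  have h3 : β * γ ^ n ≤ max β 0 * max γ 1 ^ n := by
    gcongr
    exact le_max_left _ _
  nlinarith

/-- In every set `S`, all but exponentially few vectors `x` satisfy `R n S x`. -/
def Generic (R : ∀ n, Finset (Fin n → F) → (Fin n → F) → Prop) : Prop :=
  Ubiquitous fun n B => ∀ S, B ⊆ S → ∃ x ∈ B, R n S x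

variable {R R' : ∀ n, Finset (Fin n → F) → (Fin n → F) → Prop}

open Classical in
lemma Generic.card_filter (h : Generic R) :
    Ubiquitous fun n B => ∀ S, B ⊆ S → B.card ≤ 2 * (B.filter (R n S)).card := by
  refine (Ubiquitous.subset h 2).mono fun n B hB S hBS => ?_
  by_contra! hc
  have h1 := B.card_filter_add_card_filter_not (p := R n S)
  obtain ⟨x, hx, hxR⟩ := hB (B.filter fun x => ¬ R n S x) (by omega) S
    ((Finset.filter_subset _ _).trans hBS)
  exact (Finset.mem_filter.1 hx).2 hxR

/-- Keeping the ambient `S` apart from `B` is essential here: after `B` is shrunk to the vectors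
satisfying `R`, the property `R'` still refers to the original `S`. -/
lemma Generic.and (h : Generic R) (h' : Generic R') :
    Generic fun n S x => R n S x ∧ R' n S x := by
  classical
  refine (h.card_filter.and (Ubiquitous.subset h' 2)).mono fun n B hB S hBS => ?_
  obtain ⟨x, hx, hxR⟩ := hB.2 (B.filter (R n S)) ((hB.1 S hBS).trans (Nat.le_add_right _ _)) S
    ((Finset.filter_subset _ _).trans hBS)
  exact ⟨x, (Finset.mem_filter.1 hx).1, (Finset.mem_filter.1 hx).2, hxR⟩

lemma Generic.forall_mem [Nontrivial F] {κ : Type*} (s : Finset κ)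
    {R : κ → ∀ n, Finset (Fin n → F) → (Fin n → F) → Prop} (h : ∀ a ∈ s, Generic (R a)) :
    Generic fun n S x => ∀ a ∈ s, R a n S x := by
  classical
  induction s using Finset.induction_on with
  | empty =>
    refine Ubiquitous.of_lt (β := 0) (γ := 0) (by exact_mod_cast Fintype.card_pos) le_rfl ?_
    intro n B hB S _
    rw [zero_mul, Nat.cast_pos, Finset.card_pos] at hB
    obtain ⟨x, hx⟩ := hB
    exact ⟨x, hx, by simp⟩
  | insert a s _ ih =>
    refine ((h a (by simp)).and (ih fun b hb => h b (Finset.mem_insert_of_mem hb))).mono ?_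
    intro n B hB S hBS
    obtain ⟨x, hx, h1, h2⟩ := hB S hBS
    exact ⟨x, hx, by simpa using ⟨h1, h2⟩⟩

end Ubiquitous

/-! ### Distinct solutions and avoidance of forbidden vectors -/

section Equation

variable {ι F V : Type*} [Field F]

/-- `y` is a solution of `∑ j ∈ T, c j • y j = v` in distinct elements of `S`. -/
structure IsDistinctSolution [AddCommGroup V] [Module F V] (c : ι → F) (T : Finset ι)
    (S : Finset V) (v : V) (y : ι → V) : Prop where
  mem : ∀ j ∈ T, y j ∈ S
  injOn : Set.InjOn y T
  sum_eq : ∑ j ∈ T, c j • y j = v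

/-- The equation `∑ j ∈ T, c j • y j = v` has solutions in distinct elements of `S` avoiding any
given set of at most `K` elements. -/
def IsPopular [AddCommGroup V] [Module F V] (c : ι → F) (T : Finset ι) (K : ℕ)
    (S : Finset V) (v : V) : Prop :=
  ∀ U : Finset V, U.card ≤ K → ∃ y, IsDistinctSolution c T S v y ∧ ∀ j ∈ T, y j ∉ U

/-- Solutions of equations in disjoint sets of variables can be chosen jointly distinct. -/
lemma exists_forall_isDistinctSolution {κ : Type*} [AddCommGroup V] [Module F V] [DecidableEq ι]
    {c : ι → F} {S : Finset V} {K : ℕ} (s : Finset κ) (T : κ → Finset ι)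
    (hT : (s : Set κ).PairwiseDisjoint T) (v : κ → V) (U : Finset V)
    (hK : U.card + ∑ a ∈ s, (T a).card ≤ K) (h : ∀ a ∈ s, IsPopular c (T a) K S (v a)) :
    ∃ y : ι → V, Set.InjOn y (s.biUnion T) ∧
      ∀ a ∈ s, IsDistinctSolution c (T a) S (v a) y ∧ ∀ j ∈ T a, y j ∉ U := by
  classical
  induction s using Finset.induction_on with
  | empty => exact ⟨fun _ => 0, by simp, by simp⟩
  | insert a s ha ih =>
    rw [Finset.sum_insert ha] at hK
    rw [Finset.coe_insert, Set.pairwiseDisjoint_insert_of_notMem (by exact_mod_cast ha)] at hT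
    obtain ⟨y, hy, hys⟩ := ih hT.1 (by omega) fun b hb => h b (Finset.mem_insert_of_mem hb)
    have hcard : (U ∪ (s.biUnion T).image y).card ≤ K := by
      have h1 := Finset.card_union_le U ((s.biUnion T).image y)
      have h2 : ((s.biUnion T).image y).card ≤ (s.biUnion T).card := Finset.card_image_le
      have h3 : (s.biUnion T).card ≤ ∑ a ∈ s, (T a).card := Finset.card_biUnion_le
      omega
    obtain ⟨z, hz, hzU⟩ := h a (Finset.mem_insert_self _ _) _ hcard
    have hdisj : ∀ j ∈ s.biUnion T, j ∉ T a := by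
      intro j hj hja
      obtain ⟨b, hb, hjb⟩ := Finset.mem_biUnion.1 hj
      exact Finset.disjoint_left.1 (hT.2 b hb) hja hjb
    let w : ι → V := fun j => if j ∈ T a then z j else y j
    have hwa : ∀ j ∈ T a, w j = z j := fun j hj => if_pos hj
    have hws : ∀ j ∈ s.biUnion T, w j = y j := fun j hj => if_neg (hdisj j hj)
    have hne : ∀ i ∈ T a, ∀ j ∈ s.biUnion T, w i ≠ w j := by
      intro i hi j hj hij
      rw [hwa i hi, hws j hj] at hij
      exact hzU i hi (Finset.mem_union_right _ (Finset.mem_image.2 ⟨j, hj, hij.symm⟩))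
    refine ⟨w, ?_, ?_⟩
    · intro i hi j hj hij
      simp only [Finset.biUnion_insert, Finset.coe_union, Set.mem_union, Finset.mem_coe] at hi hj
      rcases hi with hi | hi <;> rcases hj with hj | hj
      · rw [hwa i hi, hwa j hj] at hij
        exact hz.injOn hi hj hij
      · exact absurd hij (hne i hi j hj)
      · exact absurd hij.symm (hne j hj i hi)
      · rw [hws i hi, hws j hj] at hij
        exact hy hi hj hij
    · intro b hb
      rcases Finset.mem_insert.1 hb with rfl | hb
      · refine ⟨⟨fun j hj => ?_, fun i hi j hj hij => ?_, ?_⟩, fun j hj => ?_⟩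
        · rw [hwa j hj]
          exact hz.mem j hj
        · rw [hwa i hi, hwa j hj] at hij
          exact hz.injOn hi hj hij
        · rw [← hz.sum_eq]
          exact Finset.sum_congr rfl fun j hj => by rw [hwa j hj]
        · rw [hwa j hj]
          exact fun hU => hzU j hj (Finset.mem_union_left _ hU)
      · have hsub : ∀ j ∈ T b, w j = y j := fun j hj => hws j (Finset.mem_biUnion.2 ⟨b, hb, hj⟩)
        obtain ⟨hyb, hybU⟩ := hys b hb
        refine ⟨⟨fun j hj => ?_, fun i hi j hj hij => ?_, ?_⟩, fun j hj => ?_⟩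
        · rw [hsub j hj]
          exact hyb.mem j hj
        · rw [hsub i hi, hsub j hj] at hij
          exact hyb.injOn hi hj hij
        · rw [← hyb.sum_eq]
          exact Finset.sum_congr rfl fun j hj => by rw [hsub j hj]
        · rw [hsub j hj]
          exact hybU j hj

/-- A directed graph of out-degree at most `K` on `B` has an independent set of proportion
`1 / (2 * K + 1)`. -/
lemma exists_independent_subset [DecidableEq V] (K : ℕ) (B : Finset V) (U : V → Finset V)
    (hU : ∀ x ∈ B, (U x).card ≤ K) :
    ∃ B' ⊆ B, B.card ≤ (2 * K + 1) * B'.card ∧ ∀ x ∈ B', ∀ y ∈ B', y ≠ x → y ∉ U x := by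
  induction hn : B.card using Nat.strong_induction_on generalizing B with
  | _ n ih =>
    rcases B.eq_empty_or_nonempty with rfl | hB
    · exact ⟨∅, by simp, by simp [← hn], by simp⟩
    -- The average in-degree is at most `K`, so some vertex has at most `2 * K` neighbours in both
    -- directions together. Keep it, delete these, and recurse.
    obtain ⟨x, hx, hdeg⟩ : ∃ x ∈ B, (B.filter fun y => x ∈ U y).card ≤ K := by
      have hsum : ∑ x ∈ B, (B.filter fun y => x ∈ U y).card ≤ ∑ _x ∈ B, K := by
        have := Finset.sum_card_bipartiteAbove_eq_sum_card_bipartiteBelow (s := B) (t := B)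
          fun x y => x ∈ U y
        refine (le_of_eq this).trans (Finset.sum_le_sum fun y hy => ?_)
        exact (Finset.card_le_card fun z hz => (Finset.mem_filter.1 hz).2).trans (hU y hy)
      exact Finset.exists_le_of_sum_le hB hsum
    let N := insert x (U x ∪ B.filter fun y => x ∈ U y)
    have hN : N.card ≤ 2 * K + 1 := by
      have h1 := Finset.card_insert_le x (U x ∪ B.filter fun y => x ∈ U y)
      have h2 := Finset.card_union_le (U x) (B.filter fun y => x ∈ U y)
      have h3 := hU x hx
      change (insert x _ : Finset V).card ≤ _
      omega
    have hlt : (B \ N).card < n := by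
      rw [← hn]
      exact Finset.card_lt_card
        ⟨Finset.sdiff_subset, fun h => (Finset.mem_sdiff.1 (h hx)).2 (by simp [N])⟩
    obtain ⟨B', hB', hcard, hind⟩ := ih _ hlt (B \ N)
      (fun y hy => hU y (Finset.mem_sdiff.1 hy).1) rfl
    have hB'N : ∀ y ∈ B', y ≠ x ∧ y ∉ U x ∧ x ∉ U y := by
      intro y hy
      have h1 := Finset.mem_sdiff.1 (hB' hy)
      simp only [N, Finset.mem_insert, Finset.mem_union, Finset.mem_filter, not_or, not_and] at h1
      exact ⟨h1.2.1, h1.2.2.1, h1.2.2.2 h1.1⟩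
    refine ⟨insert x B', ?_, ?_, ?_⟩
    · exact Finset.insert_subset hx (hB'.trans Finset.sdiff_subset)
    · rw [Finset.card_insert_of_notMem fun h => (hB'N x h).1 rfl]
      have := Finset.le_card_sdiff N B
      rw [mul_add, mul_one]
      omega
    · intro y hy z hz hzy
      rcases Finset.mem_insert.1 hy with hyx | hy <;> rcases Finset.mem_insert.1 hz with hzx | hz
      · exact absurd (hzx.trans hyx.symm) hzy
      · exact hyx ▸ (hB'N z hz).2.1
      · exact hzx ▸ (hB'N y hy).2.2
      · exact hind y hy z hz hzy

end Equation

/-! ### Three-term equations and popular values -/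

section SingleEquation

variable {ι F : Type*} [Field F] [Fintype F]

/-- All large sets contain a solution of `∑ j ∈ T, c j • x j = 0` in distinct vectors. -/
def IsSolvableInLarge (c : ι → F) (T : Finset ι) : Prop :=
  Ubiquitous fun n S => ∃ y : ι → Fin n → F, IsDistinctSolution c T S 0 y

lemma isSolvableInLarge_of_card_eq_three {c : ι → F} {T : Finset ι} (hT : T.card = 3)
    (hc : ∀ j ∈ T, c j ≠ 0) (hsum : ∑ j ∈ T, c j = 0) : IsSolvableInLarge c T := by
  classical
  obtain ⟨i, j, l, hij, hil, hjl, rfl⟩ := Finset.card_eq_three.1 hT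
  obtain ⟨γ, hγ0, hγ, hN⟩ := exists_card_lowExponents_le (q := Fintype.card F) Fintype.one_lt_card
  have hi : i ∉ ({j, l} : Finset ι) := by simp [hij, hil]
  have hj : j ∉ ({l} : Finset ι) := by simpa using hjl
  have hsum' : c i + c j + c l = 0 := by
    rwa [Finset.sum_insert hi, Finset.sum_insert hj, Finset.sum_singleton, ← add_assoc] at hsum
  have hci : c i ≠ 0 := hc i (by simp)
  have hcj : c j ≠ 0 := hc j (by simp)
  have hcl : c l ≠ 0 := hc l (by simp)
  refine Ubiquitous.of_lt (β := 2) hγ hγ0.le fun n S hS => ?_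
  by_contra hno
  refine absurd (card_le_of_forall_three_term (c := ![c i, c j, c l])
    (by simpa [Fin.sum_univ_three] using hsum') S ?_) ?_
  · intro x hx y hy z hz h
    simp only [Matrix.cons_val] at h
    have cancel : ∀ {a : F} {u v : Fin n → F}, a ≠ 0 → a • u - a • v = 0 → u = v := by
      intro a u v ha h
      exact smul_right_injective _ ha (sub_eq_zero.1 h)
    have e1 : c l = -c i - c j := by linear_combination hsum'
    -- If two of the vectors coincide, balance and nonzero coefficients force all three to be equal.
    -- A nonconstant solution therefore has distinct entries, contradicting `hno`.
    by_cases hxy : y = x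
    · refine ⟨hxy, cancel hcl ?_⟩
      subst hxy
      rw [← h, e1]
      module
    by_cases hxz : z = x
    · subst hxz
      exact absurd (cancel hcj (by rw [← h, e1]; module)) hxy
    by_cases hyz : z = y
    · subst hyz
      exact absurd (cancel hci (by rw [← neg_eq_zero, ← h, e1]; module)) hxy
    refine absurd ⟨fun t => if t = i then x else if t = j then y else z, ?_, ?_, ?_⟩ hno
    · intro t ht
      split_ifs <;> assumption
    · intro t ht t' ht' htt
      simp only [Finset.coe_insert, Finset.coe_singleton, Set.mem_insert_iff,
        Set.mem_singleton_iff] at ht ht'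
      rcases ht with rfl | rfl | rfl <;> rcases ht' with rfl | rfl | rfl <;>
        simp_all [eq_comm]
    · rw [Finset.sum_insert hi, Finset.sum_insert hj, Finset.sum_singleton]
      simpa [hij.symm, hil.symm, hjl.symm, ← add_assoc] using h
  · rw [not_le]
    have h1 := hN n
    have : ((2 * (lowExponents (Fintype.card F) n).card : ℕ) : ℝ) < S.card := by
      push_cast
      linarith
    exact_mod_cast this

/-- The extra variable `none` plays the role of `x`. If each `x ∈ B` had a blocking set `U x`, an
independent subset of the graph `x → U x` would contain a solution of the extended equation; its
other entries avoid `U (y none)`, a contradiction. -/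
lemma generic_isPopular_of_isSolvableInLarge {c : ι → F} {T : Finset ι} (K : ℕ)
    (h : IsSolvableInLarge (fun t : Option ι => t.elim (-∑ j ∈ T, c j) c)
      (Finset.insertNone T)) :
    Generic (F := F) fun _ S x => IsPopular c T K S ((∑ j ∈ T, c j) • x) := by
  classical
  refine (Ubiquitous.subset h (2 * K + 1)).mono fun n B hB S hBS => ?_
  by_contra! hbad
  have hex : ∀ x : Fin n → F, ∃ U : Finset (Fin n → F), x ∈ B → U.card ≤ K ∧
      ¬ ∃ y, IsDistinctSolution c T S ((∑ j ∈ T, c j) • x) y ∧ ∀ j ∈ T, y j ∉ U := by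
    intro x
    by_cases hx : x ∈ B
    · have := hbad x hx
      simp only [IsPopular, not_forall] at this
      obtain ⟨U, hU, hU'⟩ := this
      exact ⟨U, fun _ => ⟨hU, hU'⟩⟩
    · exact ⟨∅, fun h => absurd h hx⟩
  choose U hU using hex
  obtain ⟨B', hB', hcard, hind⟩ := exists_independent_subset K B U fun x hx => (hU x hx).1
  obtain ⟨y, hy⟩ := hB B' (hcard.trans (Nat.le_add_right _ _))
  have hnone : y none ∈ B' := hy.mem none (by simp)
  have hsome : ∀ j ∈ T, some j ∈ Finset.insertNone T := fun j hj => by simpa using hj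
  refine (hU _ (hB' hnone)).2 ⟨fun j => y (some j), ⟨?_, ?_, ?_⟩, ?_⟩
  · exact fun j hj => hBS (hB' (hy.mem _ (hsome j hj)))
  · intro j hj j' hj' heq
    exact Option.some_injective _ (hy.injOn (hsome j hj) (hsome j' hj') heq)
  · have := hy.sum_eq
    rw [Finset.sum_insertNone] at this
    simp only [Option.elim] at this
    rw [neg_smul, neg_add_eq_zero] at this
    exact this.symm
  · refine fun j hj => hind _ hnone _ (hy.mem _ (hsome j hj)) fun heq => ?_
    exact Option.some_ne_none j (hy.injOn (hsome j hj) (by simp) heq)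

lemma generic_isPopular_zero {c : ι → F} {T : Finset ι} (K : ℕ) (h : IsSolvableInLarge c T) :
    Generic (F := F) fun _ S _ => IsPopular c T K S 0 := by
  classical
  have hB0 : Ubiquitous fun n (B : Finset (Fin n → F)) => B.Nonempty :=
    Ubiquitous.of_lt (β := 0) (γ := 0) (by exact_mod_cast Fintype.card_pos) le_rfl
      fun n B hB => by simpa [Finset.card_pos] using hB
  refine (hB0.and (Ubiquitous.subset h (K + 1))).mono fun n B ⟨⟨x, hx⟩, hB⟩ S hBS => ?_
  refine ⟨x, hx, fun U hU => ?_⟩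
  obtain ⟨y, hy⟩ := hB (B \ U) (by
    have := Finset.le_card_sdiff U B
    have := Nat.le_mul_of_pos_left (B \ U).card (Nat.add_one_pos K)
    omega)
  exact ⟨y, ⟨fun j hj => hBS (Finset.sdiff_subset (hy.mem j hj)), hy.injOn, hy.sum_eq⟩,
    fun j hj => (Finset.mem_sdiff.1 (hy.mem j hj)).2⟩

end SingleEquation

/-! ### Pigeonhole for differences -/

section Pigeonhole

variable {κ F : Type*} [Field F] [Fintype κ] {m : ℕ}

lemma exists_basis_subset {b : κ → Fin m → F} {a : κ}
    (h : Submodule.span F (b '' {a}ᶜ) = ⊤) :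
    ∃ u : Finset κ, a ∉ u ∧ u.card = m ∧ LinearIndepOn F b u := by
  classical
  obtain ⟨u, hu, -, hspan, hli⟩ := exists_linearIndepOn_extension (K := F) (v := b)
    (linearIndepOn_empty F b) (Set.empty_subset ({a}ᶜ : Set κ))
  have htop : ⊤ ≤ Submodule.span F (Set.range fun i : u => b i) := by
    rw [← h, Submodule.span_le, ← Set.image_eq_range]
    exact hspan
  have hcard := Module.finrank_eq_card_basis (Module.Basis.mk hli htop)
  refine ⟨u.toFinset, fun ha => hu (Set.mem_toFinset.1 ha) rfl, ?_, by simpa using hli⟩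
  rw [Set.toFinset_card, ← hcard, Module.finrank_fin_fun]

/-- Pigeonhole on `g ↦ ∑ a, b a ⊗ e (a, g a)` yields a large fibre. The members agreeing with a
fixed `g₀` at some `a` are few, so another member differs from `g₀` everywhere. -/
lemma exists_collision_forall_ne [Fintype F] [Nonempty κ] {b : κ → Fin m → F}
    (h : ∀ a, Submodule.span F (b '' {a}ᶜ) = ⊤) {n p : ℕ} {e : κ × Fin p → Fin n → F}
    (he : Function.Injective e)
    (hp : Fintype.card κ * Fintype.card F ^ (m * n) < p ^ (m + 1)) :
    ∃ g g' : κ → Fin p, (∀ a, g a ≠ g' a) ∧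
      ∀ i, ∑ a, b a i • (e (a, g a) - e (a, g' a)) = 0 := by
  classical
  have hm : m + 1 ≤ Fintype.card κ := by
    obtain ⟨u, hau, hu, -⟩ := exists_basis_subset (h (Classical.arbitrary κ))
    rw [← hu, ← Finset.card_insert_of_notMem hau]
    exact Finset.card_le_univ _
  let Φ : (κ → Fin p) → Fin m → Fin n → F := fun g i => ∑ a, b a i • e (a, g a)
  have hp0 : 0 < p := by
    rcases Nat.eq_zero_or_pos p with rfl | h0
    · simp at hp
    · exact h0
  have hpig : Fintype.card (Fin m → Fin n → F) *
      (Fintype.card κ * p ^ (Fintype.card κ - (m + 1))) < Fintype.card (κ → Fin p) := by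
    rw [Fintype.card_fun, Fintype.card_fun, Fintype.card_fun, Fintype.card_fin, Fintype.card_fin,
      Fintype.card_fin,
      ← pow_mul, mul_comm n m]
    calc _ = (Fintype.card κ * Fintype.card F ^ (m * n)) *
          p ^ (Fintype.card κ - (m + 1)) := by ring
      _ < p ^ (m + 1) * p ^ (Fintype.card κ - (m + 1)) := by gcongr
      _ = p ^ Fintype.card κ := by rw [← pow_add, Nat.add_sub_cancel' hm]
  obtain ⟨v, hv⟩ := Fintype.exists_lt_card_fiber_of_mul_lt_card Φ hpig
  obtain ⟨g₀, hg₀⟩ := Finset.card_pos.1 (lt_of_le_of_lt (Nat.zero_le _) hv)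
  -- With a basis `u` avoiding `a`, the coordinates outside `insert a u` determine `g` within the
  -- fibre, leaving `#κ - (m + 1)` free ones.
  have hfib : ∀ a, ((Finset.univ.filter fun g => Φ g = v).filter fun g => g a = g₀ a).card ≤
      p ^ (Fintype.card κ - (m + 1)) := by
    intro a
    obtain ⟨u, hau, hu, hli⟩ := exists_basis_subset (h a)
    have hc : Fintype.card ({x // x ∈ (insert a u)ᶜ} → Fin p) =
        p ^ (Fintype.card κ - (m + 1)) := by
      rw [Fintype.card_fun, Fintype.card_fin, Fintype.card_coe, Finset.card_compl,
        Finset.card_insert_of_notMem hau, hu]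
    rw [← hc, ← Finset.card_univ]
    refine Finset.card_le_card_of_injOn (fun g x => g x) (by simp) ?_
    intro g hg g' hg' heq
    simp only [Finset.coe_filter, Finset.mem_filter, Finset.mem_univ, true_and,
      Set.mem_ofPred_eq] at hg hg'
    have hout : ∀ x ∉ u, g x = g' x := by
      intro x hx
      by_cases hxa : x = a
      · rw [hxa, hg.2, hg'.2]
      · exact congrFun heq ⟨x, by simp [hx, hxa]⟩
    have hin : ∀ x ∈ u, ∀ t, e (x, g x) t - e (x, g' x) t = 0 := by
      intro x hx t
      refine linearIndepOn_finset_iff.1 hli (fun x => e (x, g x) t - e (x, g' x) t) ?_ x hx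
      funext i
      have h1 := congrFun (congrFun (hg.1.trans hg'.1.symm) i) t
      simp only [Φ, Finset.sum_apply, Pi.smul_apply, smul_eq_mul] at h1
      rw [← sub_eq_zero, ← Finset.sum_sub_distrib] at h1
      simp only [Finset.sum_apply, Pi.smul_apply, smul_eq_mul, Pi.zero_apply]
      rw [← h1]
      rw [Finset.sum_subset (Finset.subset_univ u) fun x _ hx => by rw [hout x hx]; ring]
      exact Finset.sum_congr rfl fun x _ => by ring
    funext x
    by_cases hx : x ∈ u
    · have := he (funext fun t => sub_eq_zero.1 (hin x hx t) : e (x, g x) = e (x, g' x))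
      exact (Prod.mk.inj this).2
    · exact hout x hx
  obtain ⟨g, hg, hne⟩ : ∃ g ∈ Finset.univ.filter (fun g => Φ g = v), ∀ a, g a ≠ g₀ a := by
    by_contra! hc
    have hsub : Finset.univ.filter (fun g => Φ g = v) ⊆ Finset.univ.biUnion fun a =>
        (Finset.univ.filter fun g => Φ g = v).filter fun g => g a = g₀ a := by
      intro g hg
      obtain ⟨a, ha⟩ := hc g hg
      exact Finset.mem_biUnion.2 ⟨a, Finset.mem_univ _, Finset.mem_filter.2 ⟨hg, ha⟩⟩
    refine absurd hv (not_lt.2 ?_)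
    calc _ ≤ _ := Finset.card_le_card hsub
      _ ≤ _ := Finset.card_biUnion_le
      _ ≤ ∑ _a : κ, p ^ (Fintype.card κ - (m + 1)) := Finset.sum_le_sum fun a _ => hfib a
      _ = _ := by simp
  refine ⟨g, g₀, hne, fun i => ?_⟩
  have h1 := congrFun ((Finset.mem_filter.1 hg).2.trans (Finset.mem_filter.1 hg₀).2.symm) i
  simp only [Φ] at h1
  rw [← sub_eq_zero, ← Finset.sum_sub_distrib] at h1
  simp_rw [smul_sub]
  exact h1

/-- If the vectors `b a` span, and still do after removing any one of them, then all large sets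
contain distinct vectors `x a`, `x' a` such that `∑ a, b a ⊗ (x a - x' a) = 0`. -/
lemma ubiquitous_exists_differences [Fintype F] {b : κ → Fin m → F}
    (h : ∀ a, Submodule.span F (b '' {a}ᶜ) = ⊤) :
    Ubiquitous fun n S => ∃ x x' : κ → Fin n → F, (∀ a, x a ∈ S ∧ x' a ∈ S) ∧
      Function.Injective (Sum.elim x x') ∧ ∀ i, ∑ a, b a i • (x a - x' a) = 0 := by
  classical
  rcases isEmpty_or_nonempty κ with hκ | hκ
  · refine Ubiquitous.of_lt (β := 0) (γ := 0) (by exact_mod_cast Fintype.card_pos) le_rfl ?_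
    exact fun n S _ => ⟨isEmptyElim, isEmptyElim, isEmptyElim,
      Function.injective_of_subsingleton _, fun i => by simp⟩
  have hq : (1 : ℝ) < Fintype.card F := by exact_mod_cast Fintype.one_lt_card
  set q : ℝ := (Fintype.card F : ℝ) with hqdef
  -- Chosen so that `γ ^ (m + 1) = q ^ m`, matching the pigeonhole count.
  set γ : ℝ := q ^ ((m : ℝ) / (m + 1)) with hγdef
  have hm0 : (0 : ℝ) < m + 1 := by positivity
  have hγq : γ < q := by
    calc γ < q ^ (1 : ℝ) := Real.rpow_lt_rpow_of_exponent_lt hq (by rw [div_lt_one hm0]; simp)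
      _ = q := Real.rpow_one q
  have hγ1 : 1 ≤ γ := Real.one_le_rpow hq.le (by positivity)
  have hγm : γ ^ (m + 1) = q ^ m := by
    rw [hγdef, ← Real.rpow_natCast, ← Real.rpow_mul (by positivity), ← Real.rpow_natCast]
    congr 1
    push_cast
    field_simp
  have hl : 0 < Fintype.card κ := Fintype.card_pos
  set l := Fintype.card κ with hldef
  -- `S` supplies `l` disjoint blocks of size `p = #S / l`. The extra `1` in `l + 1` absorbs the
  -- rounding and leaves `p > l γ ^ n`.
  refine Ubiquitous.of_lt (β := l * (l + 1)) hγq (by positivity) fun n S hS => ?_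
  obtain ⟨e⟩ : Nonempty (κ × Fin (S.card / l) ↪ S) := by
    refine Function.Embedding.nonempty_of_card_le ?_
    rw [Fintype.card_prod, Fintype.card_fin, Fintype.card_coe]
    exact Nat.mul_div_le _ _
  set p := S.card / l with hpdef
  have hp : (l : ℝ) * γ ^ n < p := by
    have h1 : S.card < l * (p + 1) := Nat.lt_mul_div_succ _ hl
    have h2 : (S.card : ℝ) < l * (p + 1) := by exact_mod_cast h1
    have h3 : (l : ℝ) * ((l + 1) * γ ^ n) < l * (p + 1) := by
      rw [← mul_assoc]
      exact hS.trans h2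
    have h4 := lt_of_mul_lt_mul_left h3 (Nat.cast_nonneg l)
    have h5 : 1 ≤ γ ^ n := one_le_pow₀ hγ1
    linarith
  have hl1 : (1 : ℝ) ≤ l := by exact_mod_cast hl
  have hpm : l * Fintype.card F ^ (m * n) < p ^ (m + 1) := by
    have : (l : ℝ) * q ^ (m * n) < (p : ℝ) ^ (m + 1) := by
      calc (l : ℝ) * q ^ (m * n) ≤ l ^ (m + 1) * q ^ (m * n) := by
            gcongr
            exact le_self_pow₀ hl1 (by omega)
        _ = (l * γ ^ n) ^ (m + 1) := by
            rw [mul_pow, ← pow_mul, mul_comm n, pow_mul γ, hγm, ← pow_mul]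
        _ < (p : ℝ) ^ (m + 1) := by gcongr
    rw [hqdef] at this
    exact_mod_cast this
  have he : Function.Injective fun t => (e t : Fin n → F) :=
    Subtype.val_injective.comp e.injective
  obtain ⟨g, g', hne, hsum⟩ := exists_collision_forall_ne h he hpm
  refine ⟨fun a => e (a, g a), fun a => e (a, g' a), fun a => ⟨(e _).2, (e _).2⟩, ?_, hsum⟩
  refine Function.Injective.sumElim ?_ ?_ ?_
  · exact fun a a' haa => (Prod.mk.inj (he haa)).1
  · exact fun a a' haa => (Prod.mk.inj (he haa)).1
  · intro a a' haa
    have := Prod.mk.inj (he haa)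
    obtain rfl := this.1
    exact hne a this.2

end Pigeonhole

/-! ### Balanced equations with at least three terms -/

section SingleEquation

variable {ι F : Type*} [Field F] [Fintype F]

/-- Solve the shorter equation among those `x` for which `(c i + c j) • x` is popular, then split
the merged term into two, avoiding the vectors already used. The splitting is a three-term equation.
-/
lemma isSolvableInLarge_of_merge [DecidableEq ι] {c : ι → F} {T : Finset ι} {i j : ι} (hi : i ∈ T)
    (hj : j ∈ T) (hij : i ≠ j) (hci : c i ≠ 0) (hcj : c j ≠ 0) (hcij : c i + c j ≠ 0)
    (h : IsSolvableInLarge (Function.update c i (c i + c j)) (T.erase j)) :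
    IsSolvableInLarge c T := by
  classical
  have hpair : IsSolvableInLarge (fun t : Option ι => t.elim (-∑ l ∈ {i, j}, c l) c)
      (Finset.insertNone {i, j}) := by
    refine isSolvableInLarge_of_card_eq_three ?_ ?_ ?_
    · rw [Finset.card_insertNone, Finset.card_pair hij]
    · rintro (_ | t) ht
      · simpa [Finset.sum_pair hij, -neg_add_rev] using hcij
      · have : t = i ∨ t = j := by simpa using ht
        rcases this with rfl | rfl <;> assumption
    · rw [Finset.sum_insertNone]
      simp
  refine ((generic_isPopular_of_isSolvableInLarge T.card hpair).card_filter.and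
    (Ubiquitous.subset h 2)).mono fun n S hS => ?_
  obtain ⟨y, hy⟩ := hS.2 _ ((hS.1 S subset_rfl).trans (Nat.le_add_right _ _))
  have hiT : i ∈ T.erase j := Finset.mem_erase.2 ⟨hij, hi⟩
  have hyi := hy.mem i hiT
  rw [Finset.mem_filter, Finset.sum_pair hij] at hyi
  obtain ⟨z, hz, hzU⟩ := hyi.2 ((T.erase j).image y)
    (Finset.card_image_le.trans (Finset.card_le_card (Finset.erase_subset _ _)))
  have hzi : i ∈ ({i, j} : Finset ι) := by simp
  have hzj : j ∈ ({i, j} : Finset ι) := by simp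
  have hzs := hz.sum_eq
  rw [Finset.sum_pair hij] at hzs
  let w : ι → Fin n → F := fun l => if l ∈ ({i, j} : Finset ι) then z l else y l
  have hw1 : ∀ l ∈ ({i, j} : Finset ι), w l = z l := fun l hl => if_pos hl
  have hw2 : ∀ l ∉ ({i, j} : Finset ι), w l = y l := fun l hl => if_neg hl
  have hTe : ∀ l ∈ T, l ∉ ({i, j} : Finset ι) → l ∈ T.erase j := by
    intro l hl hl'
    simp only [Finset.mem_insert, Finset.mem_singleton, not_or] at hl'
    exact Finset.mem_erase.2 ⟨hl'.2, hl⟩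
  have hne : ∀ l ∈ ({i, j} : Finset ι), ∀ t ∈ T, t ∉ ({i, j} : Finset ι) → w l ≠ w t := by
    intro l hl t ht ht' heq
    rw [hw1 l hl, hw2 t ht'] at heq
    exact hzU l hl (Finset.mem_image.2 ⟨t, hTe t ht ht', heq.symm⟩)
  refine ⟨w, fun l hl => ?_, fun l hl t ht heq => ?_, ?_⟩
  · by_cases hl' : l ∈ ({i, j} : Finset ι)
    · rw [hw1 l hl']
      exact hz.mem l hl'
    · rw [hw2 l hl']
      exact (Finset.mem_filter.1 (hy.mem l (hTe l hl hl'))).1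
  · by_cases hl' : l ∈ ({i, j} : Finset ι) <;> by_cases ht' : t ∈ ({i, j} : Finset ι)
    · rw [hw1 l hl', hw1 t ht'] at heq
      exact hz.injOn hl' ht' heq
    · exact absurd heq (hne l hl' t ht ht')
    · exact absurd heq.symm (hne t ht' l hl hl')
    · rw [hw2 l hl', hw2 t ht'] at heq
      exact hy.injOn (hTe l hl hl') (hTe t ht ht') heq
  · have hys := hy.sum_eq
    rw [← Finset.add_sum_erase _ _ hiT, Function.update_self, ← hzs] at hys
    rw [← Finset.add_sum_erase _ _ hj, ← Finset.add_sum_erase _ _ hiT, hw1 i hzi, hw1 j hzj,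
      ← hys, ← add_assoc, add_comm (c j • z j)]
    congr 1
    refine Finset.sum_congr rfl fun l hl => ?_
    have h1 := Finset.mem_erase.1 hl
    have h2 := Finset.mem_erase.1 h1.2
    rw [hw2 l (by simp [h1.1, h2.1]), Function.update_of_ne h1.1]

/-- This is the case where no merge is possible. Three pairwise cancelling coefficients force
characteristic 2, all coefficients equal and an even number of terms. Sums are then differences, and
the pigeonhole result with all `b a = 1` applies. -/
lemma isSolvableInLarge_of_add_eq_zero {c : ι → F} {T : Finset ι} (hT : 3 ≤ T.card)
    (hc : ∀ j ∈ T, c j ≠ 0) (hsum : ∑ j ∈ T, c j = 0)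
    (h : ∀ i ∈ T, ∀ j ∈ T, i ≠ j → c i + c j = 0) : IsSolvableInLarge c T := by
  classical
  obtain ⟨i, hi, j, hj, l, hl, hij, hil, hjl⟩ := Finset.two_lt_card.1 hT
  have hchar : c i + c i = 0 := by
    linear_combination h i hi j hj hij + h i hi l hl hil - h j hj l hl hjl
  have htwo : (2 : F) = 0 := by
    rw [← two_mul] at hchar
    exact (mul_eq_zero.1 hchar).resolve_right (hc i hi)
  have hconst : ∀ t ∈ T, c t = c i := by
    intro t ht
    by_cases hti : t = i
    · rw [hti]
    · linear_combination h t ht i hi hti - c i * htwo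
  obtain ⟨r, hr⟩ : Even T.card := by
    by_contra hodd
    obtain ⟨r, hr⟩ := Nat.not_even_iff_odd.1 hodd
    rw [Finset.sum_congr rfl hconst, Finset.sum_const, hr, nsmul_eq_mul] at hsum
    push_cast at hsum
    rw [htwo, zero_mul, zero_add, one_mul] at hsum
    exact hc i hi hsum
  obtain ⟨e⟩ : Nonempty (T ≃ Fin r ⊕ Fin r) := by
    rw [← Fintype.card_eq]
    simpa using hr
  have hspan : ∀ a : Fin r, Submodule.span F ((fun _ : Fin r => (fun _ : Fin 1 => (1 : F))) ''
      {a}ᶜ) = ⊤ := by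
    intro a
    have : Nontrivial (Fin r) := Fin.nontrivial_iff_two_le.2 (by omega)
    obtain ⟨a', ha'⟩ := exists_ne a
    refine Submodule.eq_top_iff'.2 fun v => ?_
    have : v = v 0 • fun _ : Fin 1 => (1 : F) := by
      funext t
      simp [Subsingleton.elim t 0]
    rw [this]
    exact Submodule.smul_mem _ _ (Submodule.subset_span ⟨a', ha', rfl⟩)
  refine (ubiquitous_exists_differences hspan).mono fun n S ⟨x, x', hmem, hinj, hxx⟩ => ?_
  let y : ι → Fin n → F := fun t => if ht : t ∈ T then Sum.elim x x' (e ⟨t, ht⟩) else 0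
  have hy : ∀ t (ht : t ∈ T), y t = Sum.elim x x' (e ⟨t, ht⟩) := fun t ht => dif_pos ht
  refine ⟨y, fun t ht => ?_, fun t ht t' ht' heq => ?_, ?_⟩
  · rw [hy t ht]
    rcases e ⟨t, ht⟩ with a | a
    · exact (hmem a).1
    · exact (hmem a).2
  · rw [hy t ht, hy t' ht'] at heq
    exact congrArg Subtype.val (e.injective (hinj heq))
  · have h1 : ∑ t ∈ T, c t • y t = c i • ∑ t : T, y t := by
      rw [Finset.smul_sum, ← Finset.sum_coe_sort]
      exact Finset.sum_congr rfl fun t _ => by rw [hconst t t.2]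
    have h2 : ∑ t : T, y t = ∑ t : Fin r ⊕ Fin r, Sum.elim x x' t := by
      rw [← Equiv.sum_comp e]
      exact Finset.sum_congr rfl fun t _ => hy t t.2
    have h3 : ∑ a, x' a = -∑ a, x' a := by
      rw [eq_neg_iff_add_eq_zero, ← two_smul F, htwo, zero_smul]
    have h4 := hxx 0
    simp only [one_smul, Finset.sum_sub_distrib] at h4
    rw [h1, h2, Fintype.sum_sum_type]
    simp only [Sum.elim_inl, Sum.elim_inr]
    rw [h3, ← sub_eq_add_neg, h4, smul_zero]

/-- A balanced equation with at least three nonzero coefficients has solutions in distinct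
vectors in all large sets. -/
theorem isSolvableInLarge_of_three_le {c : ι → F} {T : Finset ι} (hT : 3 ≤ T.card)
    (hc : ∀ j ∈ T, c j ≠ 0) (hsum : ∑ j ∈ T, c j = 0) : IsSolvableInLarge c T := by
  classical
  obtain ⟨r, hr⟩ : ∃ r, r = T.card := ⟨_, rfl⟩
  rw [← hr] at hT
  induction r, hT using Nat.le_induction generalizing c T with
  | base => exact isSolvableInLarge_of_card_eq_three hr.symm hc hsum
  | succ r hr3 ih =>
    by_cases h : ∀ i ∈ T, ∀ j ∈ T, i ≠ j → c i + c j = 0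
    · exact isSolvableInLarge_of_add_eq_zero (by omega) hc hsum h
    push Not at h
    obtain ⟨i, hi, j, hj, hij, hcij⟩ := h
    refine isSolvableInLarge_of_merge hi hj hij (hc i hi) (hc j hj) hcij (ih ?_ ?_ ?_)
    · intro t ht
      by_cases hti : t = i
      · rwa [hti, Function.update_self]
      · rw [Function.update_of_ne hti]
        exact hc t (Finset.mem_erase.1 ht).2
    · have hiT : i ∈ T.erase j := Finset.mem_erase.2 ⟨hij, hi⟩
      rw [← Finset.add_sum_erase _ _ hj, ← Finset.add_sum_erase _ _ hiT] at hsum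
      rw [← Finset.add_sum_erase _ _ hiT, Function.update_self, ← hsum, ← add_assoc,
        add_comm (c j)]
      congr 1
      exact Finset.sum_congr rfl fun t ht =>
        Function.update_of_ne (Finset.mem_erase.1 ht).1 _ _
    · rw [Finset.card_erase_of_mem hj]
      omega

/-- For generic `x`, the value `(∑ j ∈ T, c j) • x` is popular. -/
lemma generic_isPopular {c : ι → F} {T : Finset ι} (K : ℕ) (hT : 2 ≤ T.card)
    (hc : ∀ j ∈ T, c j ≠ 0) (h2 : T.card = 2 → ∑ j ∈ T, c j ≠ 0) :
    Generic (F := F) fun _ S x => IsPopular c T K S ((∑ j ∈ T, c j) • x) := by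
  -- If the coefficients sum to zero, then `T` itself has at least three terms; otherwise adjoining
  -- `x` provides the missing third one.
  by_cases hσ : ∑ j ∈ T, c j = 0
  · simp only [hσ, zero_smul]
    exact generic_isPopular_zero K
      (isSolvableInLarge_of_three_le (by have := mt h2 (not_not.2 hσ); omega) hc hσ)
  · refine generic_isPopular_of_isSolvableInLarge K (isSolvableInLarge_of_three_le ?_ ?_ ?_)
    · rw [Finset.card_insertNone]
      omega
    · rintro (_ | t) ht
      · exact neg_ne_zero.2 hσ
      · exact hc t (by simpa using ht)
    · rw [Finset.sum_insertNone]
      simp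

end SingleEquation

/-! ### From single equations to the system -/

section ColumnClasses

variable {F κ : Type*} [Field F] [Fintype κ] [DecidableEq κ] {m k : ℕ}
  {A : Matrix (Fin m) (Fin k) F} {f : Fin k → κ} {b : κ → Fin m → F} {c : Fin k → F}

lemma sum_smul_eq_sum_classes (hA : ∀ i j, A i j = c j * b (f j) i) {n : ℕ}
    (y : Fin k → Fin n → F) (i : Fin m) :
    ∑ j, A i j • y j = ∑ a, b a i • ∑ j with f j = a, c j • y j := by
  rw [← Finset.sum_fiberwise Finset.univ f]
  refine Finset.sum_congr rfl fun a _ => ?_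
  rw [Finset.smul_sum]
  refine Finset.sum_congr rfl fun j hj => ?_
  rw [hA, (Finset.mem_filter.1 hj).2, smul_smul, mul_comm]

lemma isModerate_of_ubiquitous [Fintype F]
    (h : Ubiquitous fun n S => ∃ x : Fin k → Fin n → F, (∀ j, x j ∈ S) ∧ IsShape A x) :
    IsModerate A := by
  obtain ⟨β, γ, hβ, hγ, hγ', h⟩ := h
  exact ⟨β, γ, by linarith, by linarith, hγ', h⟩

/-- With one generic `x`, every class of size at least two is solved for the value `(∑ c j) • x`
while avoiding `x`, and a singleton class receives `x`. Each row then evaluates as on the constant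
tuple `x`. -/
lemma isModerate_of_no_zero_pair [Fintype F] (hA : ∀ i j, A i j = c j * b (f j) i)
    (hc : ∀ j, c j ≠ 0) (hbal : IsBalanced A)
    (h1 : ∀ i j, (Finset.univ.filter fun t => f t = f i).card = 1 →
      (Finset.univ.filter fun t => f t = f j).card = 1 → f i = f j)
    (h2 : ∀ a, (Finset.univ.filter fun t => f t = a).card = 2 → ∑ j with f j = a, c j ≠ 0) :
    IsModerate A := by
  classical
  refine isModerate_of_ubiquitous ?_
  let T : κ → Finset (Fin k) := fun a => Finset.univ.filter fun t => f t = a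
  have hmemT : ∀ j a, j ∈ T a ↔ f j = a := fun j a => by simp [T]
  let s : Finset κ := Finset.univ.filter fun a => 2 ≤ (T a).card
  have hdisj : ∀ s : Set κ, s.PairwiseDisjoint T := by
    intro s a _ a' _ haa
    refine Finset.disjoint_left.2 fun j hj hj' => haa ?_
    rw [← (hmemT j a).1 hj, ← (hmemT j a').1 hj']
  have hgen : Generic (F := F) fun _ S x =>
      ∀ a ∈ s, IsPopular c (T a) (k + 1) S ((∑ j ∈ T a, c j) • x) :=
    Generic.forall_mem s (R := fun a _ S x => IsPopular c (T a) (k + 1) S ((∑ j ∈ T a, c j) • x))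
      fun a ha => generic_isPopular _ (Finset.mem_filter.1 ha).2 (fun j _ => hc j) (h2 a)
  refine hgen.mono fun n S hS => ?_
  obtain ⟨x, hx, hpop⟩ := hS S subset_rfl
  obtain ⟨y, hinj, hy⟩ := exists_forall_isDistinctSolution s T (hdisj s) _ {x} (by
    have : ∑ a ∈ s, (T a).card ≤ k := by
      rw [← Finset.card_biUnion fun a _ a' _ h => hdisj Set.univ (Set.mem_univ a)
        (Set.mem_univ a') h]
      simpa using Finset.card_le_univ (s.biUnion T)
    rw [Finset.card_singleton]
    omega) hpop
  let w : Fin k → Fin n → F := fun j => if f j ∈ s then y j else x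
  have hw1 : ∀ j, f j ∈ s → w j = y j := fun j hj => if_pos hj
  have hw2 : ∀ j, f j ∉ s → w j = x := fun j hj => if_neg hj
  have hself : ∀ j, j ∈ T (f j) := fun j => (hmemT _ _).2 rfl
  have hne : ∀ j, f j ∈ s → w j ≠ x := by
    intro j hj h
    rw [hw1 j hj] at h
    exact (hy _ hj).2 j (hself j) (Finset.mem_singleton.2 h)
  have hone : ∀ j, f j ∉ s → (T (f j)).card = 1 := by
    intro j hj
    have h3 : ¬ 2 ≤ (T (f j)).card := fun h => hj (Finset.mem_filter.2 ⟨Finset.mem_univ _, h⟩)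
    have h4 := Finset.card_pos.2 ⟨j, hself j⟩
    omega
  refine ⟨w, fun j => ?_, fun i => ?_, fun i j hij => ?_⟩
  · by_cases hj : f j ∈ s
    · rw [hw1 j hj]
      exact (hy _ hj).1.mem j (hself j)
    · rwa [hw2 j hj]
  · have hcls : ∀ a, ∑ j with f j = a, c j • w j = ∑ j with f j = a, c j • x := by
      intro a
      by_cases ha : a ∈ s
      · rw [← Finset.sum_smul, ← (hy a ha).1.sum_eq]
        refine Finset.sum_congr rfl fun j hj => ?_
        rw [hw1 j ((Finset.mem_filter.1 hj).2 ▸ ha)]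
      · refine Finset.sum_congr rfl fun j hj => ?_
        rw [hw2 j ((Finset.mem_filter.1 hj).2 ▸ ha)]
    rw [sum_smul_eq_sum_classes hA]
    simp_rw [hcls]
    rw [← sum_smul_eq_sum_classes hA, ← Finset.sum_smul, hbal i, zero_smul]
  · by_cases hi : f i ∈ s <;> by_cases hj : f j ∈ s
    · rw [hw1 i hi, hw1 j hj] at hij
      exact hinj (Finset.mem_coe.2 (Finset.mem_biUnion.2 ⟨_, hi, hself i⟩))
        (Finset.mem_coe.2 (Finset.mem_biUnion.2 ⟨_, hj, hself j⟩)) hij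
    · exact absurd (hij.trans (hw2 j hj)) (hne i hi)
    · exact absurd (hij.symm.trans (hw2 i hi)) (hne j hj)
    · have hfij := h1 i j (hone i hi) (hone j hj)
      exact Finset.card_le_one.1 (hone i hi).le i (hself i) j ((hmemT _ _).2 hfij.symm)

/-- The normalisation `c (d a) = 1` leaves coefficient sum `-1` on the rest `T' a` of the class, so
for generic `x' a` the rest can contribute `-x' a` and the class contributes `x a - x' a`. -/
lemma isModerate_of_zero_classes [Fintype F] (hA : ∀ i j, A i j = c j * b (f j) i)
    (hc : ∀ j, c j ≠ 0) {d : κ → Fin k} (hd : ∀ a, f (d a) = a) (hd1 : ∀ a, c (d a) = 1)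
    (hspan : ∀ a, Submodule.span F (b '' {a}ᶜ) = ⊤) (hzero : ∀ a, ∑ j with f j = a, c j = 0) :
    IsModerate A := by
  classical
  refine isModerate_of_ubiquitous ?_
  let T : κ → Finset (Fin k) := fun a => Finset.univ.filter fun t => f t = a
  have hmemT : ∀ j a, j ∈ T a ↔ f j = a := fun j a => by simp [T]
  let T' : κ → Finset (Fin k) := fun a => (T a).erase (d a)
  have hdT : ∀ a, d a ∈ T a := fun a => (hmemT _ _).2 (hd a)
  have hmemT' : ∀ j, j ≠ d (f j) → j ∈ T' (f j) := fun j hj =>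
    Finset.mem_erase.2 ⟨hj, (hmemT _ _).2 rfl⟩
  have hT'f : ∀ a, ∀ j ∈ T' a, f j = a := fun a j hj => (hmemT _ _).1 (Finset.mem_erase.1 hj).2
  have hσ : ∀ a, ∑ j ∈ T' a, c j = -1 := by
    intro a
    have h := hzero a
    change ∑ j ∈ T a, c j = 0 at h
    rw [← Finset.add_sum_erase _ _ (hdT a), hd1] at h
    exact (neg_eq_of_add_eq_zero_right h).symm
  have hdisj : ∀ s : Set κ, s.PairwiseDisjoint T' := by
    intro s a _ a' _ haa
    refine Finset.disjoint_left.2 fun j hj hj' => haa ?_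
    rw [← hT'f a j hj, ← hT'f a' j hj']
  -- Outside `s`, the set `T' a` is a single index with coefficient `-1`, and it takes the value `x'
  -- a` directly.
  let s : Finset κ := Finset.univ.filter fun a => 2 ≤ (T' a).card
  let K := 2 * Fintype.card κ + k
  have hgen : Generic (F := F) fun _ S x =>
      ∀ a ∈ s, IsPopular c (T' a) K S ((∑ j ∈ T' a, c j) • x) :=
    Generic.forall_mem s (R := fun a _ S x => IsPopular c (T' a) K S ((∑ j ∈ T' a, c j) • x))
      fun a ha => generic_isPopular _ (Finset.mem_filter.1 ha).2 (fun j _ => hc j) fun _ => by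
        rw [hσ]
        exact neg_ne_zero.2 one_ne_zero
  refine (hgen.card_filter.and (Ubiquitous.subset (ubiquitous_exists_differences hspan) 2)).mono
    fun n S hS => ?_
  obtain ⟨x, x', hmem, hxinj, hxx⟩ :=
    hS.2 _ ((hS.1 S subset_rfl).trans (Nat.le_add_right _ _))
  simp only [Finset.mem_filter] at hmem
  let U : Finset (Fin n → F) := Finset.univ.image (Sum.elim x x')
  have hxU : ∀ a, x a ∈ U := fun a => Finset.mem_image.2 ⟨Sum.inl a, Finset.mem_univ _, rfl⟩
  have hxU' : ∀ a, x' a ∈ U := fun a => Finset.mem_image.2 ⟨Sum.inr a, Finset.mem_univ _, rfl⟩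
  obtain ⟨y, hinj, hy⟩ := exists_forall_isDistinctSolution (c := c) (S := S) (K := K) s T'
    (hdisj s) (fun a => (∑ j ∈ T' a, c j) • x' a) U (by
      have h1 : ∑ a ∈ s, (T' a).card ≤ k := by
        rw [← Finset.card_biUnion fun a _ a' _ h => hdisj Set.univ (Set.mem_univ a)
          (Set.mem_univ a') h]
        simpa using Finset.card_le_univ (s.biUnion T')
      have h2 : U.card ≤ Fintype.card κ + Fintype.card κ := by
        rw [← Fintype.card_sum]
        exact Finset.card_image_le
      omega) fun a ha => (hmem a).2.2 a ha
  let w : Fin k → Fin n → F := fun j =>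
    if j = d (f j) then x (f j) else if f j ∈ s then y j else x' (f j)
  have hw1 : ∀ j, j = d (f j) → w j = x (f j) := fun j hj => if_pos hj
  have hw2 : ∀ j, j ≠ d (f j) → f j ∈ s → w j = y j := fun j hj hs =>
    (if_neg hj).trans (if_pos hs)
  have hw3 : ∀ j, j ≠ d (f j) → f j ∉ s → w j = x' (f j) := fun j hj hs =>
    (if_neg hj).trans (if_neg hs)
  have hyU : ∀ j, j ≠ d (f j) → f j ∈ s → w j ∉ U := by
    intro j hj hs
    rw [hw2 j hj hs]
    exact (hy _ hs).2 j (hmemT' j hj)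
  refine ⟨w, fun j => ?_, fun i => ?_, fun i j hij => ?_⟩
  · by_cases hj : j = d (f j)
    · rw [hw1 j hj]
      exact (hmem _).1.1
    by_cases hs : f j ∈ s
    · rw [hw2 j hj hs]
      exact (hy _ hs).1.mem j (hmemT' j hj)
    · rw [hw3 j hj hs]
      exact (hmem _).2.1
  · have hcls : ∀ a, ∑ j with f j = a, c j • w j = x a - x' a := by
      intro a
      change ∑ j ∈ T a, c j • w j = _
      rw [← Finset.add_sum_erase _ _ (hdT a), hd1, one_smul, hw1 _ (by rw [hd]), hd,
        sub_eq_add_neg]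
      congr 1
      have hrest : ∑ j ∈ T' a, c j • w j = (∑ j ∈ T' a, c j) • x' a := by
        have hne : ∀ j ∈ T' a, j ≠ d (f j) := fun j hj => by
          rw [hT'f a j hj]
          exact (Finset.mem_erase.1 hj).1
        by_cases ha : a ∈ s
        · rw [← (hy a ha).1.sum_eq]
          refine Finset.sum_congr rfl fun j hj => ?_
          rw [hw2 j (hne j hj) (by rwa [hT'f a j hj])]
        · rw [Finset.sum_smul]
          refine Finset.sum_congr rfl fun j hj => ?_
          rw [hw3 j (hne j hj) (by rwa [hT'f a j hj]), hT'f a j hj]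
      exact hrest.trans (by rw [hσ, neg_one_smul])
    rw [sum_smul_eq_sum_classes hA]
    simp_rw [hcls]
    exact hxx i
  · have hsmall : ∀ i j, i ≠ d (f i) → f i ∉ s → j ≠ d (f j) → f i = f j → i = j := by
      intro i j hi hs hj hf
      have h3 : ¬ 2 ≤ (T' (f i)).card := fun h => hs (Finset.mem_filter.2 ⟨Finset.mem_univ _, h⟩)
      exact Finset.card_le_one.1 (by omega) i (hmemT' i hi) j (hf ▸ hmemT' j hj)
    by_cases hi : i = d (f i) <;> by_cases hj : j = d (f j)
    · rw [hw1 i hi, hw1 j hj] at hij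
      have := Sum.inl_injective (@hxinj (Sum.inl (f i)) (Sum.inl (f j)) hij)
      rw [hi, hj, this]
    · by_cases hsj : f j ∈ s
      · exact absurd (hij ▸ hw1 i hi ▸ hxU (f i)) (hyU j hj hsj)
      · rw [hw1 i hi, hw3 j hj hsj] at hij
        exact absurd (@hxinj (Sum.inl (f i)) (Sum.inr (f j)) hij) Sum.inl_ne_inr
    · by_cases hsi : f i ∈ s
      · exact absurd (hij ▸ hw1 j hj ▸ hxU (f j)) (hyU i hi hsi)
      · rw [hw1 j hj, hw3 i hi hsi] at hij
        exact absurd (@hxinj (Sum.inl (f j)) (Sum.inr (f i)) hij.symm) Sum.inl_ne_inr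
    · by_cases hsi : f i ∈ s <;> by_cases hsj : f j ∈ s
      · rw [hw2 i hi hsi, hw2 j hj hsj] at hij
        exact hinj (Finset.mem_coe.2 (Finset.mem_biUnion.2 ⟨_, hsi, hmemT' i hi⟩))
          (Finset.mem_coe.2 (Finset.mem_biUnion.2 ⟨_, hsj, hmemT' j hj⟩)) hij
      · exact absurd (hij ▸ hw3 j hj hsj ▸ hxU' (f j)) (hyU i hi hsi)
      · exact absurd (hij ▸ hw3 i hi hsi ▸ hxU' (f i)) (hyU j hj hsj)
      · rw [hw3 i hi hsi, hw3 j hj hsj] at hij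
        exact hsmall i j hi hsi hj
          (Sum.inr_injective (@hxinj (Sum.inr (f i)) (Sum.inr (f j)) hij))

omit [Fintype κ] in
/-- In an irreducible system with several column classes, no class is needed to span the column
space. -/
lemma span_compl_eq_top (hA : ∀ i j, A i j = c j * b (f j) i) (hirr : IsIrreducible A)
    (hspan : Submodule.span F (Set.range b) = ⊤) (hf : Function.Surjective f) [Nontrivial κ]
    (a : κ) : Submodule.span F (b '' {a}ᶜ) = ⊤ := by
  classical
  by_contra hne
  -- Applying `φ` to the columns gives a combination `r₀` of the rows supported on class `a`.
  -- Subtracting multiples of it clears class `a` from every row, so the system splits along `C` and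
  -- `Cᶜ`.
  obtain ⟨φ, hφ0, hφ⟩ := Submodule.exists_le_ker_of_lt_top _ (lt_top_iff_ne_top.2 hne)
  have hφb : ∀ a' ≠ a, φ (b a') = 0 := fun a' ha' =>
    LinearMap.mem_ker.1 (hφ (Submodule.subset_span ⟨a', ha', rfl⟩))
  have hφa : φ (b a) ≠ 0 := by
    intro h0
    refine hφ0 (LinearMap.ext_on_range hspan fun a' => ?_)
    by_cases h : a' = a
    · rw [h, h0, LinearMap.zero_apply]
    · rw [hφb a' h, LinearMap.zero_apply]
  have hcol : ∀ j, A.col j = c j • b (f j) := fun j => funext fun i => by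
    simp [Matrix.col_apply, hA]
  let r₀ : Fin k → F := fun j => φ (A.col j)
  let r : Fin m → Fin k → F := fun i => A.row i - (b a i / φ (b a)) • r₀
  have hr₀ : r₀ ∈ Submodule.span F (Set.range A.row) := by
    have : r₀ = ∑ i, φ (Pi.single i 1) • A.row i := by
      funext j
      simp only [r₀, Finset.sum_apply, Pi.smul_apply, smul_eq_mul]
      conv_lhs => rw [pi_eq_sum_univ' (A.col j), map_sum]
      refine Finset.sum_congr rfl fun i _ => ?_
      rw [map_smul, smul_eq_mul, mul_comm]
      simp [Matrix.col_apply, Matrix.row_apply]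
    rw [this]
    exact Submodule.sum_mem _ fun i _ => Submodule.smul_mem _ _ (Submodule.subset_span ⟨i, rfl⟩)
  let A' : Matrix (Fin (m + 1)) (Fin k) F := Matrix.of (Fin.cons r₀ r)
  have hA'0 : A'.row 0 = r₀ := rfl
  have hA's : ∀ i : Fin m, A'.row i.succ = r i := fun i => rfl
  refine hirr ⟨m + 1, A', ⟨fun i => ?_, fun i => ?_⟩, ?_⟩
  · have : A.row i = A'.row i.succ + (b a i / φ (b a)) • A'.row 0 := by
      rw [hA'0, hA's, sub_add_cancel]
    rw [this]
    exact Submodule.add_mem _ (Submodule.subset_span ⟨_, rfl⟩)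
      (Submodule.smul_mem _ _ (Submodule.subset_span ⟨_, rfl⟩))
  · refine Fin.cases ?_ (fun i => ?_) i
    · exact hr₀
    · rw [hA's]
      exact Submodule.sub_mem _ (Submodule.subset_span ⟨i, rfl⟩) (Submodule.smul_mem _ _ hr₀)
  obtain ⟨j, hj⟩ := hf a
  obtain ⟨a', ha'⟩ := exists_ne a
  obtain ⟨j', hj'⟩ := hf a'
  let C : Finset (Fin k) := Finset.univ.filter fun t => f t = a
  have hC : C ≠ ⊥ := Finset.nonempty_iff_ne_empty.1 ⟨j, by simp [C, hj]⟩
  have hC' : Cᶜ ≠ ⊥ := Finset.nonempty_iff_ne_empty.1 ⟨j', by simp [C, hj', ha']⟩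
  have hCne : Cᶜ ≠ C := by
    intro h
    have : j ∈ Cᶜ := h ▸ (by simp [C, hj])
    simp [C, hj] at this
  let P : Finpartition (Finset.univ : Finset (Fin k)) :=
    (Finpartition.indiscrete hC).extend hC' disjoint_compl_right (Finset.union_compl C)
  have hP : P.parts = {Cᶜ, C} := rfl
  refine ⟨P, ?_, fun i => Fin.cases ⟨C, by simp [hP], fun t ht => ?_⟩
    (fun i => ⟨Cᶜ, by simp [hP], fun t ht => ?_⟩) i⟩
  · rw [hP, Finset.card_pair hCne]
  · refine Finset.mem_filter.2 ⟨Finset.mem_univ _, ?_⟩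
    by_contra hft
    refine ht ?_
    change φ (A.col t) = 0
    rw [hcol, map_smul, hφb _ hft, smul_zero]
  · simp only [C, Finset.mem_compl, Finset.mem_filter, Finset.mem_univ, true_and]
    intro hft
    refine ht ?_
    change A i t - b a i / φ (b a) * φ (A.col t) = 0
    rw [hcol, map_smul, hft, hA, hft, smul_eq_mul]
    field_simp
    ring

end ColumnClasses

end LinSys

/-! ### The main theorem -/

open LinSys in
theorem theoremA {F : Type*} [Field F] [Fintype F] {m k : ℕ} (A : Matrix (Fin m) (Fin k) F)
    (hRC : LinSys.IsTypeRC A) (hnd : LinSys.IsNondegenerate A) (hirr : LinSys.IsIrreducible A)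
    (h : (∀ C ∈ LinSys.columnClasses A, C.ncard = 2 → ¬ LinSys.SumsToZero A C) ∨
      ((∀ C ∈ LinSys.columnClasses A, LinSys.SumsToZero A C) ∧ 3 ≤ k)) :
    LinSys.IsModerate A := by
  classical
  let κ := Quotient (columnSetoid A)
  let f : Fin k → κ := Quotient.mk _
  have hf : Function.Surjective f := Quotient.mk_surjective
  have : Fintype κ := Fintype.ofFinite κ
  let d : κ → Fin k := Quotient.out
  have hd : ∀ a, f (d a) = a := Quotient.out_eq
  let b : κ → Fin m → F := fun a => A.col (d a)
  have hrel : ∀ j, ∃ x : F, x ≠ 0 ∧ A.col j = x • b (f j) := fun j =>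
    Quotient.exact (hd (f j))
  choose c hc hcol using hrel
  have hcol0 : ∀ j, A.col j ≠ 0 := fun j h0 => by
    obtain ⟨i, hi⟩ := hnd.2 j
    exact hi (congrFun h0 i)
  have hA : ∀ i j, A i j = c j * b (f j) i := fun i j => congrFun (hcol j) i
  have hd1 : ∀ a, c (d a) = 1 := by
    intro a
    have h1 := hcol (d a)
    rw [hd] at h1
    have h2 : (c (d a) - 1) • b a = 0 := by
      rw [sub_smul, one_smul, ← h1, sub_self]
    exact sub_eq_zero.1 ((smul_eq_zero.1 h2).resolve_right (hcol0 _))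
  let T : κ → Finset (Fin k) := fun a => Finset.univ.filter fun t => f t = a
  have hTcls : ∀ a, (T a : Set (Fin k)) ∈ columnClasses A := by
    intro a
    refine ⟨d a, ?_⟩
    ext t
    simp only [T, Finset.coe_filter, Finset.mem_univ, true_and, Set.mem_ofPred_eq]
    conv_lhs => rw [← hd a]
    exact Quotient.eq
  have hsum : ∀ a, SumsToZero A (T a : Set (Fin k)) ↔ ∑ j ∈ T a, c j = 0 := by
    intro a
    have h1 : ∑ j ∈ T a, A.col j = (∑ j ∈ T a, c j) • b a := by
      rw [Finset.sum_smul]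
      refine Finset.sum_congr rfl fun j hj => ?_
      rw [hcol, (Finset.mem_filter.1 hj).2]
    have h2 : SumsToZero A (T a : Set (Fin k)) ↔ (∑ j ∈ T a, c j) • b a = 0 := by
      rw [← h1, SumsToZero]
      exact Eq.congr_left (Finset.sum_congr (by ext; simp) fun _ _ => rfl)
    rw [h2, smul_eq_zero, or_iff_left (hcol0 _)]
  have hpair : (∀ a, (T a).card = 2 → ∑ j ∈ T a, c j ≠ 0) → IsModerate A := by
    intro h2
    refine isModerate_of_no_zero_pair hA hc hRC.1 (fun i j hi hj => ?_) h2
    have := hRC.2 ⟨hTcls (f i), by rw [Set.ncard_coe_finset]; exact hi⟩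
      ⟨hTcls (f j), by rw [Set.ncard_coe_finset]; exact hj⟩
    have hmem : i ∈ T (f j) := Finset.coe_injective this ▸ (by simp [T])
    simpa [T] using hmem
  rcases h with h | ⟨h, hk⟩
  · exact hpair fun a ha => mt (hsum a).2 (h _ (hTcls a) (by rw [Set.ncard_coe_finset]; exact ha))
  -- A single class has all `k ≥ 3` indices, so no class of size two exists and the first
  -- construction applies.
  rcases subsingleton_or_nontrivial κ with hκ | hκ
  · refine hpair fun a ha => absurd ha ?_
    have : T a = Finset.univ := Finset.filter_true_of_mem fun t _ => Subsingleton.elim _ _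
    rw [this, Finset.card_univ, Fintype.card_fin]
    omega
  · refine isModerate_of_zero_classes hA hc hd hd1 (span_compl_eq_top hA hirr ?_ hf)
      fun a => (hsum a).1 (h _ (hTcls a))
    have hcols : Submodule.span F (Set.range A.col) = ⊤ := by
      refine Submodule.eq_top_of_finrank_eq ?_
      rw [← Matrix.rank_eq_finrank_span_cols, hnd.1.rank_matrix, Module.finrank_fin_fun,
        Fintype.card_fin]
    rw [eq_top_iff, ← hcols, Submodule.span_le]
    rintro _ ⟨j, rfl⟩
    rw [hcol]
    exact Submodule.smul_mem _ _ (Submodule.subset_span ⟨_, rfl⟩)
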